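/- Let $\Bbbk$ be a field of characteristic different from $2$ and let $\mathcal{Q}\mathit{Sym}$ be the graded connected Hopf algebra of quasi-symmetric functions over $\Bbbk$, with monomial basis $M_\alpha=\sum_{i_1<\cdots<i_k}x_{i_1}^{a_1}\cdots x_{i_k}^{a_k}$, where $\alpha=(a_1,\ldots,a_k)$ runs over all compositions (finite sequences of positive integers, including the empty one, with $M_{(\,)}=1$), and coproduct $\Delta(M_\alpha)=\sum_{i=0}^k M_{(a_1,\ldots,a_i)}\otimes M_{(a_{i+1},\ldots,a_k)}$. Linear functionals $\mathcal{Q}\mathit{Sym}\to\Bbbk$ are multiplied by convolution, with unit the counit $\epsilon$. For a functional $\varphi$ let $\bar\varphi(h)=(-1)^n\varphi(h)$ for $h$ homogeneous of degree $n$; $\varphi$ is even if $\bar\varphi=\varphi$, and odd if it is invertible with $\varphi^{-1}=\bar\varphi$. If $\varphi(1)=1$, the even part $\varphi_+$ and the odd part $\varphi_-$ of $\varphi$ are the unique functionals such that $\varphi=\varphi_+\varphi_-$, $\varphi_+$ is even, $\varphi_-$ is odd, and $\varphi_+(1)=\varphi_-(1)=1$. Let $\zeta:\mathcal{Q}\mathit{Sym}\to\Bbbk$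 be the universal character, which sets one variable equal to $1$ and all the others equal to $0$; that is, $\zeta(M_\alpha)=1$ if $\alpha$ has at most one part, and $\zeta(M_\alpha)=0$ otherwise. Then $\zeta$ is invertible for convolution, the decomposition of $\zeta^{-1}$ into an even and an odd part exists and is unique, and its factors are given as follows. Let $C(m,n)=\dfrac{(2m)!\,(2n)!}{m!\,(m+n)!\,n!}$ (an integer). Let $\alpha=(a_1,\ldots,a_k)$ be a composition of a non-negative integer $n$, with $k(\alpha)=k$ parts, of which $k_o(\alpha)$ are odd. Then $$(\zeta^{-1})_-(M_\alpha)=\begin{cases}\dfrac{(-1)^{k(\alpha)}}{2^{2\lfloor k_o(\alpha)/2\rfloor}}\,C\bigl(0,\lfloor k_o(\alpha)/2\rfloor\bigr)&\text{if }n>0\text{ and }a_1\text{ is odd},\\[2pt] 0&\text{if }n>0\text{ and }a_1\text{ is even},\\ 1&\text{if }n=0,\end{cases}$$ $$(\zeta^{-1})_+(M_\alpha)=\begin{cases}\dfrac{(-1)^{k(\alpha)}}{2^{k_o(\alpha)}}\,C\bigl(0,k_o(\alpha)/2\bigr)&\text{if }n\text{ is even},\\[2pt] 0&\text{if }n\text{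 is odd}.\end{cases}$$ -/

import Mathlib

noncomputable section

namespace QuasiSymmetric

/-! ### Monomials in the ordered variables `x_0, x_1, x_2, …` -/

/-- The list of nonzero exponents of the monomial `x^d`, in increasing order of the variables:
for `i₁ < ⋯ < i_k` and `a_1, …, a_k > 0` the monomial `x_{i₁}^{a_1} ⋯ x_{i_k}^{a_k}` has exponent
list `[a_1, …, a_k]`. -/
def exps {σ : Type*} [LinearOrder σ] (d : σ →₀ ℕ) : List ℕ := d.support.sort.map d

theorem exps_embDomain {m : ℕ} (i : Fin m ↪o ℕ) (a : Fin m →₀ ℕ) :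
    exps (a.embDomain i.toEmbedding) = exps a := by
  unfold exps
  rw [Finsupp.support_embDomain]
  have h := StrictMonoOn.map_finsetSort i.toEmbedding (s := a.support)
    (i.strictMono.strictMonoOn _)
  rw [← h, List.map_map]
  refine List.map_congr_left fun t _ => ?_
  exact Finsupp.embDomain_apply_self i.toEmbedding a t

theorem exps_toFinsupp (l : List ℕ) (hl : ∀ a ∈ l, 0 < a) : exps l.toFinsupp = l := by
  have hs : l.toFinsupp.support = Finset.range l.length := by
    rw [List.toFinsupp_support]
    refine Finset.filter_true_of_mem fun i hi => ?_
    rw [Finset.mem_range] at hi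
    rw [List.getD_eq_getElem _ _ hi]
    exact (hl _ (List.getElem_mem hi)).ne'
  unfold exps
  rw [hs, Finset.sort_range]
  refine List.ext_getElem (by simp) fun i h1 h2 => ?_
  simp [h2]

theorem exps_pos (d : ℕ →₀ ℕ) : ∀ a ∈ exps d, 0 < a := by
  intro a ha
  obtain ⟨i, hi, rfl⟩ := List.mem_map.1 ha
  rw [Finset.mem_sort, Finsupp.mem_support_iff] at hi
  omega

theorem exps_sum (d : ℕ →₀ ℕ) : (exps d).sum = d.degree := by
  unfold exps
  rw [← List.sum_toFinset _ (Finset.sort_nodup _ _), Finset.sort_toFinset]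
  rfl

theorem exps_eq_nil {d : ℕ →₀ ℕ} : exps d = [] ↔ d = 0 := by
  unfold exps
  rw [List.map_eq_nil_iff, ← List.length_eq_zero_iff, Finset.length_sort, Finset.card_eq_zero,
    Finsupp.support_eq_empty]

theorem exists_embDomain (d : ℕ →₀ ℕ) : ∃ (m : ℕ) (a : Fin m →₀ ℕ) (i j : Fin m ↪o ℕ),
    a.embDomain i.toEmbedding = d ∧ a.embDomain j.toEmbedding = (exps d).toFinsupp := by
  have hlen : (exps d).length = d.support.card := by simp [exps]
  refine ⟨d.support.card, Finsupp.equivFunOnFinite.symm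
    (fun t => d (d.support.orderEmbOfFin rfl t)), d.support.orderEmbOfFin rfl,
    Fin.valOrderEmb _, ?_, ?_⟩
  · ext n
    by_cases hn : n ∈ d.support
    · have : n ∈ Set.range (d.support.orderEmbOfFin rfl) := by
        rw [Finset.range_orderEmbOfFin]; exact hn
      obtain ⟨t, rfl⟩ := this
      exact Finsupp.embDomain_apply_self (d.support.orderEmbOfFin rfl).toEmbedding _ t
    · rw [Finsupp.embDomain_of_notMem_range, Finsupp.notMem_support_iff.1 hn]
      intro h
      apply hn
      have h' : n ∈ Set.range (d.support.orderEmbOfFin rfl) := h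
      rw [Finset.range_orderEmbOfFin] at h'
      exact h'
  · ext n
    by_cases hn : n < d.support.card
    · have h1 := Finsupp.embDomain_apply_self (Fin.valOrderEmb d.support.card).toEmbedding
        (Finsupp.equivFunOnFinite.symm (fun t => d (d.support.orderEmbOfFin rfl t))) ⟨n, hn⟩
      refine Eq.trans h1 ?_
      rw [List.toFinsupp_apply, List.getD_eq_getElem _ _ (hlen ▸ hn)]
      simp [exps, Finset.orderEmbOfFin_apply]
    · rw [Finsupp.embDomain_of_notMem_range, List.toFinsupp_apply_le]
      · omega
      · rintro ⟨t, rfl⟩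
        exact hn t.2

/-! ### The algebra of quasi-symmetric functions -/

variable (R : Type*) [CommRing R]

/-- Quasi-symmetric functions: formal power series of bounded degree in the ordered variables
`x_0, x_1, …` such that the coefficients of `x_{i₁}^{a_1} ⋯ x_{i_m}^{a_m}` and of
`x_{j₁}^{a_1} ⋯ x_{j_m}^{a_m}` agree whenever `i₁ < ⋯ < i_m` and `j₁ < ⋯ < j_m`. -/
structure IsQuasiSymmetric (f : MvPowerSeries ℕ R) : Prop where
  bounded : ∃ N : ℕ, ∀ d : ℕ →₀ ℕ, N < d.degree → MvPowerSeries.coeff d f = 0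
  coeff_eq : ∀ (m : ℕ) (a : Fin m →₀ ℕ) (i j : Fin m ↪o ℕ),
    MvPowerSeries.coeff (a.embDomain i.toEmbedding) f =
      MvPowerSeries.coeff (a.embDomain j.toEmbedding) f

variable {R}

theorem IsQuasiSymmetric.coeff_exps {f : MvPowerSeries ℕ R} (hf : IsQuasiSymmetric R f)
    (d : ℕ →₀ ℕ) : MvPowerSeries.coeff d f = MvPowerSeries.coeff (exps d).toFinsupp f := by
  obtain ⟨m, a, i, j, hi, hj⟩ := exists_embDomain d
  have h := hf.coeff_eq m a i j
  rwa [hi, hj] at h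

theorem coeff_mul_embDomain {m : ℕ} (i : Fin m ↪o ℕ) (a : Fin m →₀ ℕ)
    (f g : MvPowerSeries ℕ R) :
    MvPowerSeries.coeff (a.embDomain i.toEmbedding) (f * g) =
      ∑ p ∈ Finset.HasAntidiagonal.antidiagonal a, MvPowerSeries.coeff (p.1.embDomain i.toEmbedding) f *
        MvPowerSeries.coeff (p.2.embDomain i.toEmbedding) g := by
  classical
  rw [MvPowerSeries.coeff_mul]
  symm
  have hadd : ∀ b c : Fin m →₀ ℕ, (b + c).embDomain i.toEmbedding =
      b.embDomain i.toEmbedding + c.embDomain i.toEmbedding := fun b c =>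
    (Finsupp.embDomain.addMonoidHom i.toEmbedding).map_add b c
  refine Finset.sum_bij (fun p _ => (p.1.embDomain i.toEmbedding, p.2.embDomain i.toEmbedding))
    ?_ ?_ ?_ ?_
  · intro p hp
    rw [Finset.HasAntidiagonal.mem_antidiagonal] at hp ⊢
    rw [← hp, hadd]
  · intro p _ q _ h
    rw [Prod.mk.injEq] at h
    exact Prod.ext (Finsupp.embDomain_injective _ h.1) (Finsupp.embDomain_injective _ h.2)
  · rintro ⟨b, c⟩ h
    rw [Finset.HasAntidiagonal.mem_antidiagonal] at h
    have hz : ∀ n, n ∉ Set.range i.toEmbedding → b n = 0 ∧ c n = 0 := by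
      intro n hn
      have := DFunLike.congr_fun h n
      simp only [Finsupp.add_apply] at this
      rw [Finsupp.embDomain_of_notMem_range _ _ _ hn] at this
      omega
    have hex : ∀ e : ℕ →₀ ℕ, (∀ n, n ∉ Set.range i.toEmbedding → e n = 0) →
        (Finsupp.equivFunOnFinite.symm fun t => e (i t)).embDomain i.toEmbedding = e := by
      intro e he
      ext n
      by_cases hn : n ∈ Set.range i.toEmbedding
      · obtain ⟨t, rfl⟩ := hn
        exact Finsupp.embDomain_apply_self i.toEmbedding _ t
      · rw [Finsupp.embDomain_of_notMem_range _ _ _ hn, he n hn]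
    refine ⟨(Finsupp.equivFunOnFinite.symm fun t => b (i t),
      Finsupp.equivFunOnFinite.symm fun t => c (i t)), ?_, ?_⟩
    · rw [Finset.HasAntidiagonal.mem_antidiagonal]
      apply Finsupp.embDomain_injective i.toEmbedding
      rw [hadd, hex b fun n hn => (hz n hn).1, hex c fun n hn => (hz n hn).2]
      exact h
    · simp only
      rw [hex b fun n hn => (hz n hn).1, hex c fun n hn => (hz n hn).2]
  · intro p _
    rfl

variable (R)

/-- The algebra of quasi-symmetric functions over `R`. -/
def QSym : Subalgebra R (MvPowerSeries ℕ R) where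
  carrier := {f | IsQuasiSymmetric R f}
  mul_mem' := by
    rintro f g ⟨⟨N, hN⟩, hf⟩ ⟨⟨K, hK⟩, hg⟩
    refine ⟨⟨N + K, fun d hd => ?_⟩, fun m a i j => ?_⟩
    · classical
      rw [MvPowerSeries.coeff_mul]
      refine Finset.sum_eq_zero fun p hp => ?_
      rw [Finset.HasAntidiagonal.mem_antidiagonal] at hp
      have hdeg : p.1.degree + p.2.degree = d.degree := by rw [← hp, map_add]
      rcases Nat.lt_or_ge N p.1.degree with h | h
      · rw [hN _ h, zero_mul]
      · rw [hK p.2 (by omega), mul_zero]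
    · rw [coeff_mul_embDomain, coeff_mul_embDomain]
      exact Finset.sum_congr rfl fun p _ => by rw [hf m p.1 i j, hg m p.2 i j]
  add_mem' := by
    rintro f g ⟨⟨N, hN⟩, hf⟩ ⟨⟨K, hK⟩, hg⟩
    refine ⟨⟨N + K, fun d hd => ?_⟩, fun m a i j => ?_⟩
    · rw [map_add, hN _ (by omega), hK _ (by omega), add_zero]
    · rw [map_add, map_add, hf m a i j, hg m a i j]
  algebraMap_mem' := by
    intro r
    classical
    refine ⟨⟨0, fun d hd => ?_⟩, fun m a i j => ?_⟩
    · rw [MvPowerSeries.algebraMap_apply, MvPowerSeries.coeff_C, if_neg]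
      rintro rfl
      simp at hd
    · simp only [MvPowerSeries.algebraMap_apply, MvPowerSeries.coeff_C,
        Finsupp.embDomain_eq_zero]

variable {R}

theorem isQuasiSymmetric_coe (f : QSym R) : IsQuasiSymmetric R (f : MvPowerSeries ℕ R) := f.2

/-! ### The monomial basis -/

variable (R)

/-- The monomial quasi-symmetric function `M_α = ∑_{i₁ < ⋯ < i_k} x_{i₁}^{a_1} ⋯ x_{i_k}^{a_k}`
of a composition `α = (a_1, …, a_k)`; here `α` is given as a list of positive integers. -/
def mono (l : List ℕ) : QSym R :=
  ⟨fun d => if exps d = l then 1 else 0, by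
    refine ⟨⟨l.sum, fun d hd => if_neg fun h => ?_⟩, fun m a i j => ?_⟩
    · rw [← h, exps_sum] at hd
      exact lt_irrefl _ hd
    · change (if _ then (1 : R) else 0) = if _ then (1 : R) else 0
      rw [exps_embDomain, exps_embDomain]⟩

/-- The monomial quasi-symmetric function `M_α` of a composition `α` of `n`. -/
abbrev M {n : ℕ} (α : Composition n) : QSym R := mono R α.blocks

variable {R}

theorem coeff_mono (l : List ℕ) (d : ℕ →₀ ℕ) :
    MvPowerSeries.coeff d (mono R l : MvPowerSeries ℕ R) = if exps d = l then 1 else 0 := rfl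

/-- The composition given by a list of positive integers. -/
def ofList (l : List ℕ) (hl : ∀ a ∈ l, 0 < a) : Σ n, Composition n :=
  ⟨l.sum, ⟨l, fun {a} ha => hl a ha, rfl⟩⟩

theorem sigma_ext {α β : Σ n, Composition n} (h : α.2.blocks = β.2.blocks) : α = β := by
  obtain ⟨n, α⟩ := α
  obtain ⟨m, β⟩ := β
  have hnm : n = m := by rw [← α.blocks_sum, ← β.blocks_sum]; exact congrArg List.sum h
  subst hnm
  have h' : α = β := Composition.ext h
  rw [h']

/-- The coordinates of a quasi-symmetric function: the coefficients of
`x_0^{a_1} ⋯ x_{k-1}^{a_k}`. -/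
def coords : QSym R →ₗ[R] ((Σ n, Composition n) →₀ R) where
  toFun f := Finsupp.ofSupportFinite
    (fun α => MvPowerSeries.coeff α.2.blocks.toFinsupp (f : MvPowerSeries ℕ R)) (by
      obtain ⟨N, hN⟩ := (isQuasiSymmetric_coe f).bounded
      refine Set.Finite.subset (Set.Finite.image
        (fun q : Σ n : Fin (N + 1), Composition n => (⟨q.1, q.2⟩ : Σ n, Composition n))
        (Set.finite_univ)) ?_
      rintro ⟨n, α⟩ hα
      have hdeg : α.blocks.toFinsupp.degree = n := by
        rw [← exps_sum, exps_toFinsupp _ (fun a ha => α.blocks_pos ha), α.blocks_sum]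
      have hn : n < N + 1 := by
        by_contra hlt
        exact hα (hN _ (by rw [hdeg]; omega))
      exact ⟨⟨⟨n, hn⟩, α⟩, trivial, rfl⟩)
  map_add' f g := by ext α; rfl
  map_smul' r f := by ext α; rfl

theorem coords_apply (f : QSym R) (α : Σ n, Composition n) :
    coords f α = MvPowerSeries.coeff α.2.blocks.toFinsupp (f : MvPowerSeries ℕ R) := rfl

theorem coords_mono (α : Σ n, Composition n) :
    coords (mono R α.2.blocks) = Finsupp.single α 1 := by
  classical
  ext β
  rw [coords_apply, coeff_mono, exps_toFinsupp _ (fun a ha => β.2.blocks_pos ha),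
    Finsupp.single_apply]
  refine if_congr ⟨fun h => (sigma_ext h).symm, fun h => by rw [h]⟩ rfl rfl

theorem coords_bijective : Function.Bijective (coords (R := R)) := by
  constructor
  · intro f g h
    ext d
    rw [(isQuasiSymmetric_coe f).coeff_exps, (isQuasiSymmetric_coe g).coeff_exps]
    exact DFunLike.congr_fun h (ofList (exps d) (exps_pos d))
  · intro c
    refine ⟨c.sum fun α r => r • mono R α.2.blocks, ?_⟩
    rw [Finsupp.sum, map_sum]
    simp only [map_smul, coords_mono, Finsupp.smul_single, smul_eq_mul, mul_one]
    exact Finsupp.sum_single c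

variable (R)

/-- The monomial basis `(M_α)` of `QSym`, indexed by all compositions. -/
def monoBasis : Module.Basis (Σ n, Composition n) R (QSym R) :=
  Module.Basis.ofRepr (LinearEquiv.ofBijective coords coords_bijective)

variable {R}

theorem monoBasis_apply (α : Σ n, Composition n) : monoBasis R α = mono R α.2.blocks := by
  have h : (monoBasis R).repr (mono R α.2.blocks) = Finsupp.single α 1 := coords_mono α
  rw [← Module.Basis.repr_symm_single_one, ← h, LinearEquiv.symm_apply_apply]

/-! ### The coalgebra structure -/

/-- The coproduct of `M_α` is `∑_{i=0}^k M_{(a_1,…,a_i)} ⊗ M_{(a_{i+1},…,a_k)}`; the counit is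
the constant coefficient. -/
instance : CoalgebraStruct R (QSym R) where
  comul := (monoBasis R).constr R fun α =>
    ∑ i ∈ Finset.range (α.2.blocks.length + 1),
      TensorProduct.tmul R (mono R (α.2.blocks.take i)) (mono R (α.2.blocks.drop i))
  counit := (MvPowerSeries.coeff (R := R) 0).comp (QSym R).val.toLinearMap

theorem comul_mono (l : List ℕ) (hl : ∀ a ∈ l, 0 < a) :
    Coalgebra.comul (R := R) (mono R l) = ∑ i ∈ Finset.range (l.length + 1),
      TensorProduct.tmul R (mono R (l.take i)) (mono R (l.drop i)) := by
  have h := monoBasis_apply (R := R) (ofList l hl)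
  have h2 : mono R l = monoBasis R (ofList l hl) := h.symm
  rw [h2]
  exact (monoBasis R).constr_basis R _ (ofList l hl)

theorem counit_mono (l : List ℕ) :
    Coalgebra.counit (R := R) (mono R l) = if l = [] then 1 else 0 := by
  change (if exps (0 : ℕ →₀ ℕ) = l then (1 : R) else 0) = _
  rw [exps_eq_nil.2 rfl]
  exact if_congr eq_comm rfl rfl

instance : Coalgebra R (QSym R) where
  coassoc := by
    refine (monoBasis R).ext fun α => ?_
    have hl : ∀ a ∈ α.2.blocks, 0 < a := fun a ha => α.2.blocks_pos ha
    rw [monoBasis_apply]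
    generalize α.2.blocks = l at hl ⊢
    simp only [LinearMap.comp_apply, LinearEquiv.coe_coe, comul_mono l hl, map_sum,
      LinearMap.rTensor_tmul, LinearMap.lTensor_tmul]
    simp only [fun i => comul_mono (R := R) (l.take i) fun a ha => hl a (List.mem_of_mem_take ha),
      fun i => comul_mono (R := R) (l.drop i) fun a ha => hl a (List.mem_of_mem_drop ha),
      TensorProduct.sum_tmul, TensorProduct.tmul_sum, map_sum, TensorProduct.assoc_tmul]
    rw [Finset.sum_sigma', Finset.sum_sigma']
    refine Finset.sum_nbij' (fun p => ⟨p.2, p.1 - p.2⟩) (fun p => ⟨p.1 + p.2, p.1⟩) ?_ ?_ ?_ ?_ ?_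
    · rintro ⟨i, j⟩ h
      simp only [Finset.mem_sigma, Finset.mem_range, List.length_take, List.length_drop] at h ⊢
      omega
    · rintro ⟨i, j⟩ h
      simp only [Finset.mem_sigma, Finset.mem_range, List.length_take, List.length_drop] at h ⊢
      omega
    · rintro ⟨i, j⟩ h
      simp only [Finset.mem_sigma, Finset.mem_range, List.length_take] at h ⊢
      have : j + (i - j) = i := by omega
      rw [this]
    · rintro ⟨i, j⟩ h
      have : i + j - i = j := by omega
      simp only [this]
    · rintro ⟨i, j⟩ h
      simp only [Finset.mem_sigma, Finset.mem_range, List.length_take] at h ⊢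
      rw [List.take_take, List.drop_take, List.drop_drop, min_eq_left (by omega),
        show j + (i - j) = i by omega]
  rTensor_counit_comp_comul := by
    refine (monoBasis R).ext fun α => ?_
    have hl : ∀ a ∈ α.2.blocks, 0 < a := fun a ha => α.2.blocks_pos ha
    rw [monoBasis_apply]
    generalize α.2.blocks = l at hl ⊢
    simp only [LinearMap.comp_apply, comul_mono l hl, map_sum, LinearMap.rTensor_tmul, counit_mono,
      TensorProduct.mk_apply]
    rw [Finset.sum_eq_single 0]
    · simp
    · intro i hi h0
      rw [Finset.mem_range] at hi
      rw [if_neg, TensorProduct.zero_tmul]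
      rw [List.take_eq_nil_iff]
      rintro (h | rfl)
      · exact h0 h
      · simp at hi; omega
    · simp
  lTensor_counit_comp_comul := by
    refine (monoBasis R).ext fun α => ?_
    have hl : ∀ a ∈ α.2.blocks, 0 < a := fun a ha => α.2.blocks_pos ha
    rw [monoBasis_apply]
    generalize α.2.blocks = l at hl ⊢
    simp only [LinearMap.comp_apply, comul_mono l hl, map_sum, LinearMap.lTensor_tmul, counit_mono,
      LinearMap.flip_apply, TensorProduct.mk_apply]
    rw [Finset.sum_eq_single l.length]
    · simp
    · intro i hi h0
      rw [Finset.mem_range] at hi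
      rw [if_neg, TensorProduct.tmul_zero]
      rw [List.drop_eq_nil_iff]
      omega
    · simp

/-! ### Functionals, convolution, even and odd parts -/

variable (R)

/-- Linear functionals on `QSym` (`WithConv` is only a type synonym); the product of this ring is the convolution product
`(ρ ψ)(h) = m ((ρ ⊗ ψ) (Δ h))` and its unit is the counit. -/
abbrev Functional : Type _ := WithConv (QSym R →ₗ[R] R)

/-- The automorphism `h ↦ (-1)^n h` for `h` homogeneous of degree `n`: on a power series it
multiplies each coefficient by `(-1)` to the degree of the monomial. -/
def bar : QSym R →ₗ[R] QSym R where
  toFun f := ⟨fun d => (-1) ^ d.degree * MvPowerSeries.coeff d (f : MvPowerSeries ℕ R), by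
    obtain ⟨⟨N, hN⟩, hf⟩ := isQuasiSymmetric_coe f
    refine ⟨⟨N, fun d hd => ?_⟩, fun m a i j => ?_⟩
    · change (-1) ^ d.degree * MvPowerSeries.coeff d (f : MvPowerSeries ℕ R) = 0
      rw [hN d hd, mul_zero]
    · change (-1) ^ _ * MvPowerSeries.coeff _ (f : MvPowerSeries ℕ R) =
        (-1) ^ _ * MvPowerSeries.coeff _ (f : MvPowerSeries ℕ R)
      rw [hf m a i j, ← exps_sum, ← exps_sum, exps_embDomain, exps_embDomain]⟩
  map_add' f g := by
    ext d
    change (-1) ^ d.degree * (MvPowerSeries.coeff d ((f + g : QSym R) : MvPowerSeries ℕ R)) =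
      (-1) ^ d.degree * MvPowerSeries.coeff d (f : MvPowerSeries ℕ R) +
        (-1) ^ d.degree * MvPowerSeries.coeff d (g : MvPowerSeries ℕ R)
    rw [Subalgebra.coe_add, map_add, mul_add]
  map_smul' r f := by
    ext d
    change (-1) ^ d.degree * (MvPowerSeries.coeff d ((r • f : QSym R) : MvPowerSeries ℕ R)) =
      r * ((-1) ^ d.degree * MvPowerSeries.coeff d (f : MvPowerSeries ℕ R))
    rw [Subalgebra.coe_smul, map_smul, smul_eq_mul]
    ring

variable {R}

theorem bar_mono (l : List ℕ) : bar R (mono R l) = (-1 : R) ^ l.sum • mono R l := by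
  ext d
  change (-1) ^ d.degree * (if exps d = l then (1 : R) else 0) =
    (-1) ^ l.sum * (if exps d = l then (1 : R) else 0)
  split_ifs with h
  · rw [← h, exps_sum]
  · simp

/-- The functional `φ̄`, given by `φ̄(h) = φ(h̄)`. -/
def Functional.bar (φ : Functional R) : Functional R :=
  WithConv.toConv (φ.ofConv.comp (QuasiSymmetric.bar R))

/-- A functional is even if `φ̄ = φ`. -/
def Functional.IsEven (φ : Functional R) : Prop := φ.bar = φ

/-- A functional is odd if it is invertible for convolution, with inverse `φ̄`. -/
def Functional.IsOdd (φ : Functional R) : Prop := φ * φ.bar = 1 ∧ φ.bar * φ = 1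

/-- `φ = ρ ψ` with `ρ` even, `ψ` odd and `ρ(1) = ψ(1) = 1`. -/
structure Functional.IsEvenOddDecomposition (φ ρ ψ : Functional R) : Prop where
  even_one : ρ 1 = 1
  odd_one : ψ 1 = 1
  even : ρ.IsEven
  odd : ψ.IsOdd
  eq_mul : φ = ρ * ψ

open Classical in
/-- The even part `φ₊` of `φ`: the even factor in the decomposition of `φ`
(by convention `0` if there is no decomposition). -/
def Functional.evenPart (φ : Functional R) : Functional R :=
  if h : ∃ p : Functional R × Functional R, φ.IsEvenOddDecomposition p.1 p.2
  then h.choose.1 else 0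

open Classical in
/-- The odd part `φ₋` of `φ`: the odd factor in the decomposition of `φ`
(by convention `0` if there is no decomposition). -/
def Functional.oddPart (φ : Functional R) : Functional R :=
  if h : ∃ p : Functional R × Functional R, φ.IsEvenOddDecomposition p.1 p.2
  then h.choose.2 else 0

/-! ### The universal character -/

theorem exists_polynomial (f : QSym R) : ∃ p : Polynomial R,
    (∀ n, p.coeff n = MvPowerSeries.coeff (Finsupp.single 0 n) (f : MvPowerSeries ℕ R)) := by
  obtain ⟨N, hN⟩ := (isQuasiSymmetric_coe f).bounded
  refine ⟨∑ n ∈ Finset.range (N + 1), Polynomial.monomial n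
    (MvPowerSeries.coeff (Finsupp.single 0 n) (f : MvPowerSeries ℕ R)), fun n => ?_⟩
  rw [Polynomial.finsetSum_coeff]
  simp only [Polynomial.coeff_monomial, Finset.sum_ite_eq', Finset.mem_range]
  split_ifs with h
  · rfl
  · rw [hN]
    rw [Finsupp.degree_single]
    omega

/-- The value of `f` at `x_0 = 1`, `x_1 = x_2 = ⋯ = 0`: the (finite) sum of the coefficients
of the powers of `x_0`. -/
def specialize (f : QSym R) : R :=
  ∑ᶠ n : ℕ, MvPowerSeries.coeff (Finsupp.single 0 n) (f : MvPowerSeries ℕ R)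

theorem specialize_eq_eval (f : QSym R) (p : Polynomial R)
    (hp : ∀ n, p.coeff n = MvPowerSeries.coeff (Finsupp.single 0 n) (f : MvPowerSeries ℕ R)) :
    specialize f = p.eval 1 := by
  unfold specialize
  simp only [← hp]
  rw [Polynomial.eval_eq_sum, Polynomial.sum, finsum_eq_sum_of_support_subset _ (s := p.support)]
  · simp
  · intro n hn
    simpa using hn

variable (R)

/-- The universal character `ζ` of `QSym`: set one variable to `1` and all others to `0`. -/
def zetaHom : QSym R →ₐ[R] R where
  toFun := specialize
  map_one' := by
    classical
    rw [specialize_eq_eval 1 1, Polynomial.eval_one]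
    intro n
    rw [OneMemClass.coe_one, MvPowerSeries.coeff_one, Polynomial.coeff_one]
    simp
  map_mul' f g := by
    obtain ⟨p, hp⟩ := exists_polynomial f
    obtain ⟨q, hq⟩ := exists_polynomial g
    rw [specialize_eq_eval f p hp, specialize_eq_eval g q hq, specialize_eq_eval (f * g) (p * q),
      Polynomial.eval_mul]
    intro n
    classical
    rw [Polynomial.coeff_mul, MulMemClass.coe_mul, MvPowerSeries.coeff_mul,
      Finsupp.antidiagonal_single, Finset.sum_map]
    refine Finset.sum_congr rfl fun x _ => ?_
    rw [hp, hq]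
    rfl
  map_zero' := by
    rw [specialize_eq_eval 0 0 (by simp), Polynomial.eval_zero]
  map_add' f g := by
    obtain ⟨p, hp⟩ := exists_polynomial f
    obtain ⟨q, hq⟩ := exists_polynomial g
    rw [specialize_eq_eval f p hp, specialize_eq_eval g q hq, specialize_eq_eval (f + g) (p + q),
      Polynomial.eval_add]
    intro n
    rw [Polynomial.coeff_add, hp, hq, Subalgebra.coe_add, map_add]
  commutes' r := by
    classical
    rw [specialize_eq_eval (algebraMap R (QSym R) r) (Polynomial.C r), Polynomial.eval_C]
    · rfl
    intro n
    rw [Subalgebra.coe_algebraMap, MvPowerSeries.algebraMap_apply, MvPowerSeries.coeff_C,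
      Polynomial.coeff_C]
    simp

/-- The universal character `ζ` as an element of the convolution ring. -/
def zeta : Functional R := WithConv.toConv (zetaHom R).toLinearMap

/-- The inverse `ζ⁻¹` of the universal character for convolution. -/
def zetaInv : Functional R := Ring.inverse (zeta R)

/-! ### Numbers -/

/-- The bivariate Catalan number `C(m,n) = (2m)! (2n)! / (m! (m+n)! n!)`, which is an integer. -/
def bivariateCatalan (m n : ℕ) : ℕ :=
  ((2 * m).factorial * (2 * n).factorial) / (m.factorial * (m + n).factorial * n.factorial)

theorem bivariateCatalan_dvd (m n : ℕ) :
    m.factorial * (m + n).factorial * n.factorial ∣ (2 * m).factorial * (2 * n).factorial := by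
  induction m generalizing n with
  | zero =>
    have h := Nat.factorial_mul_factorial_dvd_factorial_add n n
    simpa [two_mul] using h
  | succ m ih =>
    obtain ⟨c, hc⟩ := ih n
    obtain ⟨e, he⟩ := ih (n + 1)
    have h1 : (2 * (n + 1)).factorial = (2 * n + 2) * ((2 * n + 1) * (2 * n).factorial) := rfl
    have h2 : (2 * (m + 1)).factorial = (2 * m + 2) * ((2 * m + 1) * (2 * m).factorial) := rfl
    have h3 : (m + (n + 1)).factorial = (m + n + 1) * (m + n).factorial := rfl
    have h4 : (m + 1 + n).factorial = (m + n + 1) * (m + n).factorial := by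
      rw [show m + 1 + n = m + n + 1 by omega]; rfl
    rw [h1, h3, Nat.factorial_succ] at he
    rw [h2, h4, Nat.factorial_succ]
    rw [← Int.natCast_dvd_natCast]
    refine ⟨4 * c - e, ?_⟩
    zify at hc he
    push_cast at hc he ⊢
    have hn : ((n : ℤ) + 1) ≠ 0 := by positivity
    apply mul_left_cancel₀ hn
    linear_combination 4 * (n + 1 : ℤ) * (m + 1) * (m + n + 1) * hc - (m + 1 : ℤ) * he

theorem bivariateCatalan_zero (n : ℕ) : bivariateCatalan 0 n = n.centralBinom := by
  unfold bivariateCatalan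
  rw [Nat.centralBinom_eq_two_mul_choose, Nat.choose_eq_factorial_div_factorial (by omega),
    show 2 * n - n = n by omega]
  simp

/-- The number `k_o(α)` of odd parts of a composition. -/
def numOdd {n : ℕ} (α : Composition n) : ℕ := α.blocks.countP fun a => a % 2 = 1

end QuasiSymmetric

end

/-! ### Central binomial coefficients -/

section CentralBinom

open PowerSeries

/-! Up to the sign `(-1)^k`, every functional here is a function on words, and convolution becomes
convolution along cuts of a word (`ofWord_mul`). In this normalisation `ζ⁻¹` is the constant word
function `1`, and `bar` multiplies by `(-1)^s`, where `s` is the number of odd letters. Everything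
then reduces to power series in one variable whose exponent is `s`.

Let `E = (1 - X^2)^{-1/2}`. The even factor takes the coefficient of `X^s` in `E`. The odd factor
takes that of `F = (1 + X) E`, but only on the empty word and on words with odd first letter. This
restriction lets exactly one cut contribute for each way of splitting the odd letters in two, so
convolution becomes the Cauchy product (`conv_oddCount_leadOdd`, `conv_leadOdd_leadOdd_of_odd`). The
decomposition thus amounts to `E F = 1/(1 - X)` and `F(X) F(-X) = 1`.

Uniqueness: `φ = ρ ψ` forces `φ.bar * ψ^2 = φ`. If `φ` is invertible this determines `ψ^2`, hence
`ψ`, because square roots with value `1` at `1` are unique when `2 ≠ 0`. -/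

/-- The generating function `∑ (2m choose m) X^m` is an inverse square root of `1 - 4X`. -/
theorem PowerSeries.one_sub_four_mul_X_mul_centralBinom_sq :
    (1 - 4 * X) * (PowerSeries.mk fun n => (n.centralBinom : ℤ)) ^ 2 = 1 := by
  set P : ℤ⟦X⟧ := PowerSeries.mk fun n => (n.centralBinom : ℤ) with hP
  -- The recurrence `(n + 1) c_{n+1} = 2 (2n + 1) c_n` of the central binomial coefficients, written
  -- as a differential equation.
  have hd : (1 - 4 * X) * derivative ℤ P = 2 * P := by
    ext n
    have h4 : (4 : ℤ⟦X⟧) = C (4 : ℤ) := by simp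
    have h2 : (2 : ℤ⟦X⟧) = C (2 : ℤ) := by simp
    rw [sub_mul, one_mul, mul_assoc, h4, h2, map_sub, coeff_C_mul, coeff_C_mul]
    have h := Nat.succ_mul_centralBinom_succ n
    zify at h
    rcases n with _ | n
    · simp [hP, coeff_derivative, Nat.centralBinom, Nat.choose]
    · rw [coeff_succ_X_mul, coeff_derivative, coeff_derivative, hP, coeff_mk, coeff_mk]
      push_cast at h ⊢
      linear_combination h
  -- By `hd` the left side has derivative zero. Concluding that it is constant needs a torsion-free
  -- ring, hence the detour through `ℤ`.
  apply derivative.ext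
  · rw [Derivation.leibniz, Derivation.leibniz_pow, map_sub, Derivation.leibniz, derivative_X,
      derivative_one]
    have h4 : derivative ℤ (4 : ℤ⟦X⟧) = 0 := by
      have : (4 : ℤ⟦X⟧) = C (4 : ℤ) := by simp
      rw [this, derivative_C]
    simp only [h4, smul_eq_mul, nsmul_eq_mul]
    push_cast
    linear_combination 2 * P * hd
  · simp [hP]

variable (k : Type*) [Field k]

/-- The power series `(1 - X^2)^{-1/2}`. -/
noncomputable def invSqrtSeries : k⟦X⟧ :=
  PowerSeries.expand 2 two_ne_zero (PowerSeries.mk fun m => (m.centralBinom : k) / 4 ^ m)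

variable {k}

theorem coeff_invSqrtSeries_two_mul (m : ℕ) :
    coeff (2 * m) (invSqrtSeries k) = (m.centralBinom : k) / 4 ^ m := by
  rw [invSqrtSeries, coeff_expand_mul, coeff_mk]

theorem coeff_invSqrtSeries_of_odd {s : ℕ} (hs : Odd s) : coeff s (invSqrtSeries k) = 0 :=
  coeff_expand_of_not_dvd _ _ _ fun h => Nat.not_even_iff_odd.2 hs (even_iff_two_dvd.2 h)

/-- The integral identity is mapped to `k`, then `X` is replaced by `X/4` (possible as `2 ≠ 0`) and
finally by `X^2`; no derivative is taken in `k`. -/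
theorem one_sub_X_sq_mul_invSqrtSeries_sq (h2 : (2 : k) ≠ 0) :
    (1 - X ^ 2) * invSqrtSeries k ^ 2 = 1 := by
  have h4 : (4 : k) ≠ 0 := by
    have : (4 : k) = 2 * 2 := by norm_num
    rw [this]
    exact mul_ne_zero h2 h2
  have hc : (PowerSeries.mk fun m => (m.centralBinom : k) / 4 ^ m) =
      rescale (4⁻¹ : k) (PowerSeries.map (Int.castRingHom k)
        (PowerSeries.mk fun n => (n.centralBinom : ℤ))) := by
    ext n
    simp [div_eq_inv_mul]
  have h := congrArg (fun f => rescale (4⁻¹ : k) (PowerSeries.map (Int.castRingHom k) f))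
    one_sub_four_mul_X_mul_centralBinom_sq
  simp only [map_mul, map_sub, map_one, map_pow, map_ofNat, PowerSeries.map_X, rescale_X,
    ← hc] at h
  have hX : (4 : k⟦X⟧) * (C (4⁻¹ : k) * X) = X := by
    have h4' : (4 : k⟦X⟧) = C (4 : k) := (map_ofNat (C (R := k)) 4).symm
    rw [h4', ← mul_assoc, ← map_mul, mul_inv_cancel₀ h4, map_one, one_mul]
  rw [hX] at h
  have h' := congrArg (PowerSeries.expand 2 two_ne_zero) h
  simpa only [map_mul, map_sub, map_one, map_pow, PowerSeries.expand_X, invSqrtSeries] using h'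

/-- Since `invSqrtSeries` has only even powers, the factor `1 + X` copies each even coefficient to
the next odd place; this is the source of the floor in the odd part. -/
theorem coeff_one_add_X_mul_invSqrtSeries (s : ℕ) :
    coeff s ((1 + X) * invSqrtSeries k) = ((s / 2).centralBinom : k) / 4 ^ (s / 2) := by
  rw [add_mul, one_mul, map_add]
  obtain ⟨m, rfl | rfl⟩ := s.even_or_odd'
  · rw [coeff_invSqrtSeries_two_mul, Nat.mul_div_cancel_left _ two_pos]
    rcases m with _ | m
    · simp
    · rw [show 2 * (m + 1) = 2 * m + 1 + 1 by ring, coeff_succ_X_mul,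
        coeff_invSqrtSeries_of_odd (odd_two_mul_add_one m), add_zero]
  · rw [coeff_invSqrtSeries_of_odd (odd_two_mul_add_one m), coeff_succ_X_mul,
      coeff_invSqrtSeries_two_mul, zero_add, show (2 * m + 1) / 2 = m by omega]

/-- This is the substitution of `-X` for `X`, under which `invSqrtSeries` is invariant. -/
theorem coeff_one_sub_X_mul_invSqrtSeries (s : ℕ) :
    coeff s ((1 - X) * invSqrtSeries k) = (-1) ^ s * coeff s ((1 + X) * invSqrtSeries k) := by
  rw [add_mul, sub_mul, one_mul, map_add, map_sub]
  obtain ⟨m, rfl | rfl⟩ := s.even_or_odd'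
  · rcases m with _ | m
    · simp
    · rw [show 2 * (m + 1) = 2 * m + 1 + 1 by ring, coeff_succ_X_mul,
        coeff_invSqrtSeries_of_odd (odd_two_mul_add_one m), ← show 2 * (m + 1) = 2 * m + 1 + 1 by
          ring, (even_two_mul (m + 1)).neg_one_pow]
      ring
  · rw [coeff_invSqrtSeries_of_odd (odd_two_mul_add_one m), (odd_two_mul_add_one m).neg_one_pow]
    ring

end CentralBinom

namespace QuasiSymmetric

/-! ### Functionals and their values on the monomial basis -/

section Words

variable {R : Type*} [CommRing R]

/-- The convolution of two functions on words with respect to deconcatenation. -/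
def conv (f g : List ℕ → R) : List ℕ → R
  | [] => f [] * g []
  | a :: l => f [] * g (a :: l) + conv (fun t => f (a :: t)) g l

/-- The sum matches the coproduct; the recursive `conv` allows induction on the first letter. -/
theorem sum_take_drop (f g : List ℕ → R) (l : List ℕ) :
    ∑ i ∈ Finset.range (l.length + 1), f (l.take i) * g (l.drop i) = conv f g l := by
  induction l generalizing f with
  | nil => simp [conv]
  | cons a l ih =>
    rw [List.length_cons, Finset.sum_range_succ', conv, ← ih]
    simp [add_comm]

theorem Functional.ext_mono {φ ψ : Functional R}
    (h : ∀ l : List ℕ, (∀ a ∈ l, 0 < a) → φ (mono R l) = ψ (mono R l)) : φ = ψ := by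
  refine WithConv.ext ((monoBasis R).ext fun α => ?_)
  rw [monoBasis_apply]
  exact h _ fun a ha => α.2.blocks_pos ha

theorem Functional.mul_mono (φ ψ : Functional R) {l : List ℕ} (hl : ∀ a ∈ l, 0 < a) :
    (φ * ψ) (mono R l) = conv (fun t => φ (mono R t)) (fun t => ψ (mono R t)) l := by
  rw [← sum_take_drop, LinearMap.convMul_apply, comul_mono l hl, map_sum, map_sum]
  simp

theorem Functional.one_mono (l : List ℕ) :
    (1 : Functional R) (mono R l) = if l = [] then 1 else 0 := by
  rw [LinearMap.convOne_apply, counit_mono]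
  rfl

theorem mono_nil : mono R [] = 1 := by
  classical
  ext d
  rw [coeff_mono, OneMemClass.coe_one, MvPowerSeries.coeff_one]
  exact if_congr exps_eq_nil rfl rfl

/-- The functional with value `(-1)^k f(α)` at `M_α`, for a composition `α` with `k` parts. -/
noncomputable def ofWord (f : List ℕ → R) : Functional R :=
  WithConv.toConv ((monoBasis R).constr R fun α => (-1) ^ α.2.blocks.length * f α.2.blocks)

theorem ofWord_mono (f : List ℕ → R) {l : List ℕ} (hl : ∀ a ∈ l, 0 < a) :
    ofWord f (mono R l) = (-1) ^ l.length * f l := by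
  have h : monoBasis R (ofList l hl) = mono R l := monoBasis_apply (ofList l hl)
  rw [← h]
  exact (monoBasis R).constr_basis R _ (ofList l hl)

theorem ofWord_one (f : List ℕ → R) : ofWord f 1 = f [] := by
  rw [← mono_nil, ofWord_mono f (by simp)]
  simp

theorem conv_congr {f f' g g' : List ℕ → R} {l : List ℕ} (hf : ∀ t, t <+: l → f t = f' t)
    (hg : ∀ t, t <:+ l → g t = g' t) : conv f g l = conv f' g' l := by
  rw [← sum_take_drop, ← sum_take_drop]
  exact Finset.sum_congr rfl fun i _ => by
    rw [hf _ (List.take_prefix i l), hg _ (List.drop_suffix i l)]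

/-- Lengths add under a cut, so the sign built into `ofWord` is multiplicative and drops out. -/
theorem ofWord_mul (f g : List ℕ → R) : ofWord f * ofWord g = ofWord (conv f g) := by
  refine Functional.ext_mono fun l hl => ?_
  rw [Functional.mul_mono _ _ hl, ofWord_mono _ hl, ← sum_take_drop, ← sum_take_drop,
    Finset.mul_sum]
  refine Finset.sum_congr rfl fun i _ => ?_
  rw [ofWord_mono _ fun a ha => hl a (List.mem_of_mem_take ha),
    ofWord_mono _ fun a ha => hl a (List.mem_of_mem_drop ha)]
  have h : (-1 : R) ^ l.length = (-1) ^ (l.take i).length * (-1) ^ (l.drop i).length := by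
    rw [← pow_add, ← List.length_append, List.take_append_drop]
  rw [h]
  ring

theorem ofWord_eq_one {f : List ℕ → R} (h0 : f [] = 1) (h : ∀ a l, f (a :: l) = 0) :
    ofWord f = 1 := by
  refine Functional.ext_mono fun l hl => ?_
  rw [ofWord_mono f hl, Functional.one_mono]
  cases l with
  | nil => simp [h0]
  | cons a l => simp [h]

/-- The number of odd letters of a word. -/
def oddCount (l : List ℕ) : ℕ := l.countP fun a => a % 2 = 1

theorem oddCount_cons_of_odd {a : ℕ} (ha : Odd a) (l : List ℕ) :
    oddCount (a :: l) = oddCount l + 1 :=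
  List.countP_cons_of_pos (by simpa using Nat.odd_iff.1 ha)

theorem oddCount_cons_of_not_odd {a : ℕ} (ha : ¬ Odd a) (l : List ℕ) :
    oddCount (a :: l) = oddCount l :=
  List.countP_cons_of_neg (by simpa [Nat.odd_iff] using ha)

theorem neg_one_pow_sum (l : List ℕ) : (-1 : R) ^ l.sum = (-1) ^ oddCount l := by
  induction l with
  | nil => rfl
  | cons a l ih =>
    rw [List.sum_cons, pow_add, ih]
    by_cases ha : Odd a
    · rw [oddCount_cons_of_odd ha, ha.neg_one_pow, pow_succ, mul_comm]
    · rw [oddCount_cons_of_not_odd ha, (Nat.not_odd_iff_even.1 ha).neg_one_pow, one_mul]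

theorem even_sum_iff (l : List ℕ) : Even l.sum ↔ Even (oddCount l) := by
  induction l with
  | nil => rfl
  | cons a l ih =>
    rw [List.sum_cons, Nat.even_add, ih]
    by_cases ha : Odd a
    · rw [oddCount_cons_of_odd ha, Nat.even_add_one, ← Nat.not_odd_iff_even]
      tauto
    · rw [oddCount_cons_of_not_odd ha]
      rw [Nat.not_odd_iff_even] at ha
      tauto

theorem Functional.bar_mono (φ : Functional R) (l : List ℕ) :
    φ.bar (mono R l) = (-1) ^ oddCount l * φ (mono R l) := by
  change φ.ofConv (QuasiSymmetric.bar R (mono R l)) = _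
  rw [QuasiSymmetric.bar_mono, map_smul, neg_one_pow_sum, smul_eq_mul]

theorem ofWord_bar (f : List ℕ → R) :
    (ofWord f).bar = ofWord fun l => (-1) ^ oddCount l * f l := by
  refine Functional.ext_mono fun l hl => ?_
  rw [Functional.bar_mono, ofWord_mono _ hl, ofWord_mono _ hl]
  ring

theorem oddCount_append (l t : List ℕ) : oddCount (l ++ t) = oddCount l + oddCount t :=
  List.countP_append

theorem Functional.bar_mul (φ ψ : Functional R) : (φ * ψ).bar = φ.bar * ψ.bar := by
  refine Functional.ext_mono fun l hl => ?_
  rw [bar_mono, mul_mono _ _ hl, mul_mono _ _ hl, ← sum_take_drop, ← sum_take_drop, Finset.mul_sum]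
  refine Finset.sum_congr rfl fun i _ => ?_
  rw [bar_mono, bar_mono]
  have h : (-1 : R) ^ oddCount l = (-1) ^ oddCount (l.take i) * (-1) ^ oddCount (l.drop i) := by
    rw [← pow_add, ← oddCount_append, List.take_append_drop]
  rw [h]
  ring

theorem Functional.bar_bar (φ : Functional R) : φ.bar.bar = φ := by
  refine Functional.ext_mono fun l _ => ?_
  rw [bar_mono, bar_mono, ← mul_assoc, ← mul_pow]
  simp

theorem Functional.bar_one : (1 : Functional R).bar = 1 := by
  refine Functional.ext_mono fun l _ => ?_
  rw [bar_mono, one_mono]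
  split_ifs with h
  · subst h
    simp [oddCount]
  · simp

theorem Functional.isUnit_bar {φ : Functional R} (h : IsUnit φ) : IsUnit φ.bar := by
  obtain ⟨⟨u, v, huv, hvu⟩, rfl⟩ := h
  exact ⟨⟨u.bar, v.bar, by rw [← bar_mul, huv, bar_one], by rw [← bar_mul, hvu, bar_one]⟩, rfl⟩

/-! ### Uniqueness of the decomposition -/

/-- A functional with value `1` at `1` is determined by its square. -/
theorem Functional.eq_of_mul_self_eq [IsDomain R] (h2 : (2 : R) ≠ 0) {φ ψ : Functional R}
    (hφ : φ 1 = 1) (hψ : ψ 1 = 1) (h : φ * φ = ψ * ψ) : φ = ψ := by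
  rw [← mono_nil] at hφ hψ
  refine Functional.ext_mono fun l hl => ?_
  induction hn : l.length using Nat.strong_induction_on generalizing l with
  | _ n ih =>
    subst hn
    rcases hm : l.length with _ | m
    · rw [List.length_eq_zero_iff.1 hm, hφ, hψ]
    · have h' : (φ * φ) (mono R l) = (ψ * ψ) (mono R l) := by rw [h]
      -- The two extreme cuts each contribute the value at `l` itself; the inner cuts involve
      -- shorter words only and agree by induction. What remains is `2 φ(M_l) = 2 ψ(M_l)`.
      rw [mul_mono _ _ hl, mul_mono _ _ hl, ← sum_take_drop, ← sum_take_drop, hm,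
        Finset.sum_range_succ, Finset.sum_range_succ', Finset.sum_range_succ,
        Finset.sum_range_succ'] at h'
      have hmid : ∀ i ∈ Finset.range m,
          φ (mono R (l.take (i + 1))) * φ (mono R (l.drop (i + 1))) =
            ψ (mono R (l.take (i + 1))) * ψ (mono R (l.drop (i + 1))) := by
        intro i hi
        rw [Finset.mem_range] at hi
        rw [ih _ (by rw [List.length_take]; omega) (l.take (i + 1))
            (fun a ha => hl a (List.mem_of_mem_take ha)) rfl,
          ih _ (by rw [List.length_drop]; omega) (l.drop (i + 1))
            (fun a ha => hl a (List.mem_of_mem_drop ha)) rfl]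
      rw [Finset.sum_congr rfl hmid, List.take_zero, List.drop_zero,
        List.take_of_length_le hm.le, List.drop_of_length_le hm.le, hφ, hψ] at h'
      exact mul_left_cancel₀ h2 (by linear_combination h')

/-- Here `φ.bar = ρ * ψ.bar`, and `ψ.bar` cancels one factor `ψ`. The even factor is thereby
eliminated. -/
theorem Functional.IsEvenOddDecomposition.bar_mul_mul {φ ρ ψ : Functional R}
    (h : φ.IsEvenOddDecomposition ρ ψ) : φ.bar * (ψ * ψ) = φ := by
  have he : ρ.bar = ρ := h.even
  rw [h.eq_mul, bar_mul, he, mul_assoc, ← mul_assoc ψ.bar, h.odd.2, one_mul]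

theorem Functional.IsEvenOddDecomposition.unique [IsDomain R] (h2 : (2 : R) ≠ 0)
    {φ ρ ψ ρ' ψ' : Functional R} (hφ : IsUnit φ) (h : φ.IsEvenOddDecomposition ρ ψ)
    (h' : φ.IsEvenOddDecomposition ρ' ψ') : ρ = ρ' ∧ ψ = ψ' := by
  have hψ : ψ = ψ' := eq_of_mul_self_eq h2 h.odd_one h'.odd_one
    ((isUnit_bar hφ).mul_left_cancel (h.bar_mul_mul.trans h'.bar_mul_mul.symm))
  subst hψ
  refine ⟨?_, rfl⟩
  have hρ : ρ * ψ = ρ' * ψ := h.eq_mul.symm.trans h'.eq_mul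
  rw [← mul_one ρ, ← mul_one ρ', ← h.odd.1, ← mul_assoc, ← mul_assoc, hρ]

theorem Functional.IsEvenOddDecomposition.parts_eq [IsDomain R] (h2 : (2 : R) ≠ 0)
    {φ ρ ψ : Functional R} (hφ : IsUnit φ) (h : φ.IsEvenOddDecomposition ρ ψ) :
    φ.evenPart = ρ ∧ φ.oddPart = ψ := by
  have hex : ∃ p : Functional R × Functional R, φ.IsEvenOddDecomposition p.1 p.2 := ⟨(ρ, ψ), h⟩
  rw [evenPart, oddPart, dif_pos hex, dif_pos hex]
  exact unique h2 hφ hex.choose_spec h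

/-! ### Functionals depending on odd parts only -/

/-- The word function `l ↦ b (oddCount l)` if `l` is empty or its first letter is odd, and `0`
otherwise. -/
def leadOdd (b : ℕ → R) : List ℕ → R
  | [] => b 0
  | a :: l => if Odd a then b (oddCount (a :: l)) else 0

/-- Only cuts at the end of the word or just before an odd letter contribute, and among these each
number of odd letters in the suffix occurs exactly once. -/
theorem conv_oddCount_leadOdd (a b : ℕ → R) (l : List ℕ) :
    conv (fun t => a (oddCount t)) (leadOdd b) l =
      ∑ p ∈ Finset.HasAntidiagonal.antidiagonal (oddCount l), a p.1 * b p.2 := by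
  induction l generalizing a with
  | nil => simp [conv, leadOdd, oddCount]
  | cons x l ih =>
    rw [conv, leadOdd]
    by_cases hx : Odd x
    · simp only [oddCount_cons_of_odd hx, if_pos hx]
      -- The cut before `x` is the term `(0, s)` of the antidiagonal; for the other cuts `x` lies in
      -- the prefix, which shifts `a` by one.
      rw [ih fun n => a (n + 1), Finset.Nat.antidiagonal_succ, Finset.sum_cons, Finset.sum_map]
      rfl
    · simp only [oddCount_cons_of_not_odd hx, if_neg hx]
      rw [ih a, mul_zero, zero_add]

/-- Every nonempty prefix starts with the odd letter `x`, so on prefixes the first factor depends on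
`oddCount` alone. -/
theorem conv_leadOdd_leadOdd_of_odd (a b : ℕ → R) {x : ℕ} (hx : Odd x) (l : List ℕ) :
    conv (leadOdd a) (leadOdd b) (x :: l) =
      ∑ p ∈ Finset.HasAntidiagonal.antidiagonal (oddCount (x :: l)), a p.1 * b p.2 := by
  rw [← conv_oddCount_leadOdd]
  refine conv_congr (fun t ht => ?_) fun _ _ => rfl
  cases t with
  | nil => rfl
  | cons y t =>
    obtain rfl : y = x := (List.cons_prefix_cons.1 ht).1
    rw [leadOdd, if_pos hx]

theorem conv_zero_left (g : List ℕ → R) (l : List ℕ) : conv (fun _ => 0) g l = 0 := by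
  rw [← sum_take_drop]
  simp

/-- The first factor vanishes on nonempty prefixes; for the empty prefix the second vanishes on the
whole word. -/
theorem conv_leadOdd_leadOdd_of_not_odd (a b : ℕ → R) {x : ℕ} (hx : ¬ Odd x) (l : List ℕ) :
    conv (leadOdd a) (leadOdd b) (x :: l) = 0 := by
  simp only [conv, leadOdd, if_neg hx, mul_zero, conv_zero_left, add_zero]

theorem neg_one_pow_mul_leadOdd (b : ℕ → R) (l : List ℕ) :
    (-1) ^ oddCount l * leadOdd b l = leadOdd (fun s => (-1) ^ s * b s) l := by
  cases l with
  | nil => simp [leadOdd, oddCount]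
  | cons x l => simp only [leadOdd, mul_ite, mul_zero]

end Words

/-! ### The universal character -/

section Zeta

variable {R : Type*} [CommRing R]

theorem exps_single (n : ℕ) :
    exps (Finsupp.single 0 n : ℕ →₀ ℕ) = if n = 0 then [] else [n] := by
  split_ifs with h
  · rw [h, Finsupp.single_zero, exps_eq_nil]
  · rw [exps, Finsupp.support_single _ h, Finset.sort_singleton]
    simp

theorem zeta_mono {l : List ℕ} (hl : ∀ a ∈ l, 0 < a) :
    zeta R (mono R l) = if l.length ≤ 1 then 1 else 0 := by
  change specialize (mono R l) = _
  match l with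
  | [] =>
    rw [specialize_eq_eval _ 1]
    · simp
    · intro n
      rw [coeff_mono, exps_single, Polynomial.coeff_one]
      split_ifs <;> simp_all
  | [a] =>
    rw [specialize_eq_eval _ (Polynomial.X ^ a)]
    · simp
    · intro n
      have ha := hl a (by simp)
      rw [coeff_mono, exps_single, Polynomial.coeff_X_pow]
      split_ifs <;> simp_all
  | a :: b :: t =>
    rw [specialize_eq_eval _ 0]
    · simp
    · intro n
      rw [coeff_mono, exps_single, Polynomial.coeff_zero]
      split_ifs <;> simp_all

/-- The word function of the universal character. -/
def zetaWord : List ℕ → R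
  | [] => 1
  | [_] => -1
  | _ :: _ :: _ => 0

theorem zeta_eq_ofWord : zeta R = ofWord zetaWord := by
  refine Functional.ext_mono fun l hl => ?_
  rw [zeta_mono hl, ofWord_mono _ hl]
  match l with
  | [] => simp [zetaWord]
  | [a] => simp [zetaWord]
  | a :: b :: t => simp [zetaWord]

/-- On a nonempty word only the prefixes of length `0` and `1` count, with weights `1` and `-1`. The
product in the other order is checked separately, as convolution is not commutative in general. -/
theorem zeta_mul_ofWord_one : zeta R * ofWord (fun _ => 1) = 1 := by
  rw [zeta_eq_ofWord, ofWord_mul]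
  refine ofWord_eq_one (by simp [conv, zetaWord]) fun a l => ?_
  cases l with
  | nil => simp [conv, zetaWord]
  | cons b l => simp [conv, zetaWord, conv_zero_left]

theorem ofWord_one_mul_zeta : ofWord (fun _ => 1) * zeta R = 1 := by
  rw [zeta_eq_ofWord, ofWord_mul]
  have h : ∀ (l : List ℕ), conv (fun _ => (1 : R)) zetaWord l = if l = [] then 1 else 0 := by
    intro l
    induction l with
    | nil => simp [conv, zetaWord]
    | cons a l ih =>
      rw [conv, ih]
      cases l <;> simp [zetaWord]
  exact ofWord_eq_one (by simp [h]) fun a l => by simp [h]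

variable (R)

theorem isUnit_zeta : IsUnit (zeta R) :=
  ⟨⟨_, _, zeta_mul_ofWord_one, ofWord_one_mul_zeta⟩, rfl⟩

theorem zetaInv_eq_ofWord : zetaInv R = ofWord fun _ => 1 := by
  rw [zetaInv]
  exact Ring.inverse_unit ⟨zeta R, _, zeta_mul_ofWord_one, ofWord_one_mul_zeta⟩

theorem isUnit_zetaInv : IsUnit (zetaInv R) := by
  rw [zetaInv_eq_ofWord]
  exact ⟨⟨_, _, ofWord_one_mul_zeta, zeta_mul_ofWord_one⟩, rfl⟩

end Zeta

/-! ### Even-odd decomposition of the inverse universal character -/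

section Decomposition

open PowerSeries

variable {k : Type*} [Field k]

theorem isEvenOddDecomposition_zetaInv (h2 : (2 : k) ≠ 0) :
    (zetaInv k).IsEvenOddDecomposition
      (ofWord fun l => coeff (oddCount l) (invSqrtSeries k))
      (ofWord (leadOdd fun s => coeff s ((1 + X) * invSqrtSeries k))) := by
  have hE := one_sub_X_sq_mul_invSqrtSeries_sq h2
  have hψ : ofWord (leadOdd fun s => coeff s ((1 + X) * invSqrtSeries k)) *
      (ofWord (leadOdd fun s => coeff s ((1 + X) * invSqrtSeries k))).bar = 1 := by
    simp only [ofWord_bar, neg_one_pow_mul_leadOdd, ← coeff_one_sub_X_mul_invSqrtSeries,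
      ofWord_mul]
    -- `F(X) F(-X) = (1 - X^2) E^2 = 1`.
    have hmul : ((1 + X) * invSqrtSeries k) * ((1 - X) * invSqrtSeries k) = 1 := by
      linear_combination hE
    refine ofWord_eq_one ?_ fun x l => ?_
    · have h := congrArg (coeff 0) hmul
      rw [coeff_mul] at h
      simpa [conv, leadOdd] using h
    · by_cases hx : Odd x
      · rw [conv_leadOdd_leadOdd_of_odd _ _ hx, ← coeff_mul, hmul, coeff_one,
          oddCount_cons_of_odd hx, if_neg (Nat.succ_ne_zero _)]
      · exact conv_leadOdd_leadOdd_of_not_odd _ _ hx l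
  refine ⟨?_, ?_, ?_, ⟨hψ, ?_⟩, ?_⟩
  · rw [ofWord_one]
    simpa [oddCount] using coeff_invSqrtSeries_two_mul (k := k) 0
  · rw [ofWord_one, leadOdd, coeff_one_add_X_mul_invSqrtSeries]
    simp
  · rw [Functional.IsEven, ofWord_bar]
    congr 1
    funext l
    rcases Nat.even_or_odd (oddCount l) with h | h
    · rw [h.neg_one_pow, one_mul]
    · rw [coeff_invSqrtSeries_of_odd h, mul_zero]
  · have h := congrArg Functional.bar hψ
    rwa [Functional.bar_mul, Functional.bar_bar, Functional.bar_one] at h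
  · rw [zetaInv_eq_ofWord, ofWord_mul]
    congr 1
    funext l
    rw [conv_oddCount_leadOdd (fun s => coeff s (invSqrtSeries k)), ← coeff_mul]
    -- `(1 + X) E^2 = (1 + X)/(1 - X^2) = 1/(1 - X)`, the series with all coefficients `1`.
    have hmul : invSqrtSeries k * ((1 + X) * invSqrtSeries k) = PowerSeries.mk 1 := by
      have h1 := PowerSeries.mk_one_mul_one_sub_eq_one k
      linear_combination (PowerSeries.mk 1) * hE -
        (invSqrtSeries k * ((1 + X) * invSqrtSeries k)) * h1
    rw [hmul, coeff_mk, Pi.one_apply]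

end Decomposition

end QuasiSymmetric

/-! ### Explicit values of the even and odd parts -/

open QuasiSymmetric in
theorem theoremT (k : Type*) [Field k] (h2 : (2 : k) ≠ 0) :
    -- `ζ` is invertible for convolution, and `ζ⁻¹` has exactly one even-odd decomposition,
    -- whose factors are its even and odd parts
    IsUnit (zeta k) ∧
    (∀ ρ ψ : Functional k, (zetaInv k).IsEvenOddDecomposition ρ ψ ↔
      ρ = (zetaInv k).evenPart ∧ ψ = (zetaInv k).oddPart) ∧
    -- values of the odd part, at nonempty compositions and at the empty one
    (∀ (n : ℕ) (α : Composition n) (a : ℕ), α.blocks.head? = some a →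
      (zetaInv k).oddPart (M k α) =
        if Odd a then
          (-1) ^ α.length / 2 ^ (2 * (numOdd α / 2)) * (bivariateCatalan 0 (numOdd α / 2) : k)
        else 0) ∧
    (∀ α : Composition 0, (zetaInv k).oddPart (M k α) = 1) ∧
    -- values of the even part
    (∀ (n : ℕ) (α : Composition n), (zetaInv k).evenPart (M k α) =
      if Even n then
        (-1) ^ α.length / 2 ^ numOdd α * (bivariateCatalan 0 (numOdd α / 2) : k)
      else 0) := by
  have hdec := isEvenOddDecomposition_zetaInv h2
  obtain ⟨he, ho⟩ := hdec.parts_eq h2 (isUnit_zetaInv k)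
  have h4 : (4 : k) = 2 ^ 2 := by norm_num
  refine ⟨isUnit_zeta k, fun ρ ψ => ⟨fun h => ?_, ?_⟩, fun n α a ha => ?_, fun α => ?_,
    fun n α => ?_⟩
  · rw [he, ho]
    exact h.unique h2 (isUnit_zetaInv k) hdec
  · rintro ⟨rfl, rfl⟩
    rw [he, ho]
    exact hdec
  · rw [ho, ofWord_mono _ fun _ => α.blocks_pos, Composition.blocks_length]
    change _ = if Odd a then (-1) ^ α.length / 2 ^ (2 * (oddCount α.blocks / 2)) *
      (bivariateCatalan 0 (oddCount α.blocks / 2) : k) else 0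
    obtain ⟨l, hl⟩ : ∃ l, α.blocks = a :: l := ⟨_, (List.cons_head?_tail ha).symm⟩
    rw [hl, leadOdd, coeff_one_add_X_mul_invSqrtSeries, bivariateCatalan_zero, h4, ← pow_mul]
    split_ifs
    · ring
    · rw [mul_zero]
  · have h0 : α.blocks = [] := by
      rw [← List.length_eq_zero_iff, Composition.blocks_length]
      exact Nat.le_zero.1 α.length_le
    rw [M, h0, mono_nil, ho]
    exact hdec.odd_one
  · rw [he, ofWord_mono _ fun _ => α.blocks_pos, Composition.blocks_length]
    change _ = if Even n then (-1) ^ α.length / 2 ^ oddCount α.blocks *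
      (bivariateCatalan 0 (oddCount α.blocks / 2) : k) else 0
    -- The degree and the number of odd parts have the same parity, so odd `n` meets a vanishing
    -- coefficient of the even series `E`.
    have hiff : Even n ↔ Even (oddCount α.blocks) := by rw [← even_sum_iff, α.blocks_sum]
    by_cases hn : Even n
    · rw [if_pos hn]
      obtain ⟨m, hm⟩ := even_iff_two_dvd.1 (hiff.1 hn)
      rw [hm, coeff_invSqrtSeries_two_mul, Nat.mul_div_cancel_left _ two_pos,
        bivariateCatalan_zero, h4, ← pow_mul]
      ring
    · rw [if_neg hn, coeff_invSqrtSeries_of_odd (Nat.not_even_iff_odd.1 (mt hiff.2 hn)), mul_zero]
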